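/- Let $N,M\ge 1$ be integers, $\sigma>0$, and let $\rho$ be real with $0<|\rho|<1$. Let $x_{0n},y_{0n}$ ($1\le n\le N$) and $x_{mn},y_{mn}$ ($2\le m\le M$, $1\le n\le N$) be mutually independent real Gaussian random variables with mean $0$ and variance $1/2$. Define the equally correlated Rayleigh fading channel coefficients between the $N$ transmit antennas and the $M$ ports of the MISO fluid antenna system by \[ h_{1n}=\sigma x_{0n}+j\sigma y_{0n},\qquad h_{mn}=\sigma\bigl(\sqrt{1-\rho^2}\,x_{mn}+\rho x_{0n}\bigr)+j\sigma\bigl(\sqrt{1-\rho^2}\,y_{mn}+\rho y_{0n}\bigr)\quad(2\le m\le M), \] and the maximum-ratio-transmission precoding gains by $X_m=\sum_{n=1}^N|h_{mn}|^2$, $1\le m\le M$. Then $(X_1,\dots,X_M)$ has a joint probability density function with respect to Lebesgue measure on $\mathbb R^M$, and (up to a null set) it equals \[ p_{X_1,\dots,X_M}(z_1,\dots,z_M)=\frac{z_1^{N-1}}{\sigma^{2N}(N-1)!}\,e^{-z_1/\sigma^2}\prod_{m=2}^M\frac{1}{\sigma^2(1-\rho^2)}\,e^{-\frac{z_m+\rho^2z_1}{\sigma^2(1-\rho^2)}}\left(\frac{z_m}{\rho^2z_1}\right)^{\frac{N-1}{2}}I_{N-1}\!\left(\frac{\sqrt{4\rho^2z_1z_m}}{\sigma^2(1-\rho^2)}\right)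 \] when all $z_m>0$, and $0$ otherwise, where $I_{N-1}(t)=\sum_{k\ge0}\frac{(t/2)^{2k+N-1}}{k!\,(k+N-1)!}$ is the modified Bessel function of the first kind. -/

import Mathlib

open MeasureTheory ProbabilityTheory

noncomputable section

namespace MisoFas

/-- Modified Bessel function of the first kind, of order `n : ℕ`, at a real argument:
`I_n(x) = ∑_k (x/2)^(2k+n) / (k! (n+k)!)` (a series that converges for every real `x`). -/
def besselI (n : ℕ) (x : ℝ) : ℝ :=
  ∑' k : ℕ, (x / 2) ^ (2 * k + n) / ((Nat.factorial k : ℝ) * (Nat.factorial (n + k) : ℝ))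

/-- The Gaussian variables that drive the channel: all the `x m n` and `y m n` are
`N(0, 1/2)`-distributed and they are mutually independent. Row `0` is the common component
`x₀ₙ, y₀ₙ`; row `m ≠ 0` is the component that belongs to port `m` alone. -/
structure IsDrivingNoise {Ω : Type*} [MeasurableSpace Ω] {M N : ℕ}
    (x y : Fin M → Fin N → Ω → ℝ) (μ : Measure Ω) : Prop where
  law_x : ∀ m n, HasLaw (x m n) (gaussianReal 0 (1 / 2)) μ
  law_y : ∀ m n, HasLaw (y m n) (gaussianReal 0 (1 / 2)) μ
  indep : iIndepFun (Sum.elim (fun i : Fin M × Fin N => x i.1 i.2)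
    (fun i : Fin M × Fin N => y i.1 i.2)) μ

/-- Channel coefficient between the `n`-th transmit antenna and the `m`-th port. The ports are
numbered from `0`, so that port `0` is the first one, whose channel is the common component. -/
def channel {Ω : Type*} {M N : ℕ} [NeZero M] (σ ρ : ℝ) (x y : Fin M → Fin N → Ω → ℝ)
    (m : Fin M) (n : Fin N) (ω : Ω) : ℂ :=
  if m = 0 then
    ((σ * x 0 n ω : ℝ) : ℂ) + Complex.I * ((σ * y 0 n ω : ℝ) : ℂ)
  else
    ((σ * (√(1 - ρ ^ 2) * x m n ω + ρ * x 0 n ω) : ℝ) : ℂ)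
      + Complex.I * ((σ * (√(1 - ρ ^ 2) * y m n ω + ρ * y 0 n ω) : ℝ) : ℂ)

/-- The precoding gain of port `m` under maximum-ratio transmission. -/
def precodingGain {Ω : Type*} {M N : ℕ} [NeZero M] (σ ρ : ℝ) (x y : Fin M → Fin N → Ω → ℝ)
    (m : Fin M) (ω : Ω) : ℝ :=
  ∑ n : Fin N, ‖channel σ ρ x y m n ω‖ ^ 2

/-- The joint density of the precoding gains; it vanishes off the positive orthant. -/
def jointDensity {M : ℕ} [NeZero M] (N : ℕ) (σ ρ : ℝ) (z : Fin M → ℝ) : ℝ :=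
  open Classical in
  if ∀ m, 0 < z m then
    z 0 ^ (N - 1) / (σ ^ (2 * N) * (Nat.factorial (N - 1) : ℝ)) * Real.exp (-(z 0 / σ ^ 2)) *
      ∏ m ∈ Finset.univ.erase (0 : Fin M),
        (1 / (σ ^ 2 * (1 - ρ ^ 2))
          * Real.exp (-((z m + ρ ^ 2 * z 0) / (σ ^ 2 * (1 - ρ ^ 2))))
          * (z m / (ρ ^ 2 * z 0)) ^ (((N : ℝ) - 1) / 2)
          * besselI (N - 1) (√(4 * ρ ^ 2 * z 0 * z m) / (σ ^ 2 * (1 - ρ ^ 2))))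
  else 0

end MisoFas

end

namespace MisoFas

open Filter Topology

/-! Condition on the noise of port `0`. Every other gain is then a sum of `2N` squares of
independent Gaussians with common scale `σ√(1-ρ²)` and means `σρ` times the frozen noise, so it is
noncentral chi-square. Its noncentrality is the sum of the squared means, which is `ρ²` times the
gain of port `0`. The frozen noise thus enters only through that gain, and the other gains are
conditionally independent because each uses its own noise. The joint density is therefore a central
chi-square (Gamma) density in `z 0` times a product of noncentral densities with noncentrality `ρ² z
0`.

The chi-square law (`map_sum_sq_gaussian`) comes from comparing exponential moments, which determine
a finite measure (`measure_ext_of_lintegral_exp`). The density is handled as a Poisson mixture of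
Gammas, so that its moments are an exponential series. The conditioning argument is `map_gainMap`,
checked on boxes by Tonelli. Resumming the mixture gives the Bessel form
(`noncentralPDF_eq_besselI`). -/

/-! ### Exponential moments: uniqueness, and squares of Gaussians. -/

/-- Two finite measures on `ℝ` whose exponential moments of every order `t < r`, with `r > 0`, are
finite and agree, are equal. -/
theorem measure_ext_of_lintegral_exp {μ ν : Measure ℝ} [IsFiniteMeasure μ] [IsFiniteMeasure ν]
    {r : ℝ} (hr : 0 < r)
    (hfin : ∀ t < r, ∫⁻ x, ENNReal.ofReal (Real.exp (t * x)) ∂μ ≠ ⊤)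
    (heq : ∀ t < r, ∫⁻ x, ENNReal.ofReal (Real.exp (t * x)) ∂μ =
      ∫⁻ x, ENNReal.ofReal (Real.exp (t * x)) ∂ν) : μ = ν := by
  have hint : ∀ {m : Measure ℝ}, (∀ t < r, ∫⁻ x, ENNReal.ofReal (Real.exp (t * x)) ∂m ≠ ⊤) →
      Set.Iio r ⊆ interior (integrableExpSet id m) := by
    intro m hm
    refine interior_maximal (fun t ht => ?_) isOpen_Iio
    change Integrable (fun x => Real.exp (t * x)) m
    exact ⟨by fun_prop, (hasFiniteIntegral_iff_ofReal
      (ae_of_all _ fun x => (Real.exp_pos _).le)).2 (hm t ht).lt_top⟩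
  have hμ := hint hfin
  have hν : Set.Iio r ⊆ interior (integrableExpSet id ν) :=
    hint fun t ht => heq t ht ▸ hfin t ht
  have hmgf : ∀ t < r, mgf id μ t = mgf id ν t := by
    intro t ht
    simp only [mgf, id]
    rw [integral_eq_lintegral_of_nonneg_ae (ae_of_all _ fun x => (Real.exp_pos _).le)
      (by fun_prop), integral_eq_lintegral_of_nonneg_ae
      (ae_of_all _ fun x => (Real.exp_pos _).le) (by fun_prop), heq t ht]
  -- Identity theorem: agreement at real points near `0` spreads over the half-plane `re z < r`.
  -- Since `0 < r`, this contains the imaginary axis, where the complex mgf is the characteristic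
  -- function.
  have hEq : Set.EqOn (complexMGF id μ) (complexMGF id ν) {z : ℂ | z.re < r} := by
    refine AnalyticOnNhd.eqOn_of_preconnected_of_frequently_eq (z₀ := 0)
      (analyticOnNhd_complexMGF.mono fun z hz => hμ hz)
      (analyticOnNhd_complexMGF.mono fun z hz => hν hz)
      (convex_halfSpace_re_lt r).isPreconnected (by simpa using hr) ?_
    have hreal : ∃ᶠ x : ℝ in 𝓝[≠] 0, complexMGF id μ x = complexMGF id ν x := by
      refine Eventually.frequently ?_
      filter_upwards [nhdsWithin_le_nhds (Iio_mem_nhds hr)] with x hx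
      rw [complexMGF_ofReal, complexMGF_ofReal, hmgf x hx]
    have htend : Tendsto (fun x : ℝ => (x : ℂ)) (𝓝[≠] 0) (𝓝[≠] 0) := by
      refine tendsto_nhdsWithin_iff.2 ⟨?_, ?_⟩
      · exact (Complex.continuous_ofReal.tendsto' 0 0 (by simp)).mono_left nhdsWithin_le_nhds
      · filter_upwards [self_mem_nhdsWithin] with x hx
        simpa using hx
    exact htend.frequently hreal
  refine Measure.ext_of_charFun (funext fun t => ?_)
  rw [← complexMGF_id_mul_I, ← complexMGF_id_mul_I]
  exact hEq (by simpa using hr)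

/-- The integral of a nonnegative product function over a finite product of real lines. -/
theorem lintegral_fin_prod_eq_prod {n : ℕ} {E : Fin n → Type*} {mE : ∀ i, MeasurableSpace (E i)}
    {μ : ∀ i, Measure (E i)} [∀ i, SigmaFinite (μ i)] {f : ∀ i, E i → ENNReal}
    (hf : ∀ i, Measurable (f i)) :
    ∫⁻ x, ∏ i, f i (x i) ∂Measure.pi μ = ∏ i, ∫⁻ x, f i x ∂μ i := by
  induction n with
  | zero => simp
  | succ n ih =>
    rw [← ((measurePreserving_piFinSuccAbove μ 0).symm).lintegral_comp_emb
      (MeasurableEquiv.measurableEmbedding _)]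
    simp_rw [MeasurableEquiv.piFinSuccAbove_symm_apply, Fin.insertNthEquiv,
      Fin.prod_univ_succ]
    have := lintegral_prod_mul (μ := μ 0) (ν := Measure.pi fun i : Fin n => μ i.succ) (f := f 0)
      (g := fun x => ∏ i : Fin n, f i.succ (x i)) (hf 0).aemeasurable
      (Finset.measurable_prod _ fun i _ => (hf _).comp (measurable_pi_apply i)).aemeasurable
    rw [ih fun i => hf _] at this
    simpa using! this

/-- The exponential moments of the square of a Gaussian variable of variance `c ^ 2 / 2`. -/
theorem lintegral_exp_sq_gaussianReal (c a t : ℝ) (ht : c ^ 2 * t < 1) :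
    ∫⁻ x, ENNReal.ofReal (Real.exp (t * (c * x + a) ^ 2)) ∂gaussianReal 0 (1 / 2) =
      ENNReal.ofReal ((√(1 - c ^ 2 * t))⁻¹ * Real.exp (a ^ 2 * (t / (1 - c ^ 2 * t)))) := by
  have hb : 0 < 1 - c ^ 2 * t := by linarith
  set b := 1 - c ^ 2 * t with hbdef
  rw [gaussianReal_of_var_ne_zero _ (by norm_num), lintegral_withDensity_eq_lintegral_mul _
    (measurable_gaussianPDF _ _) (by fun_prop)]
  -- Variance `1/2` makes the density `exp(-x²)/√π`. Completing the square, `-x² + t(cx+a)² = -b(x -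
  -- tca/b)² + a²t/b`.
  have hpt : ∀ x : ℝ, (gaussianPDF 0 (1 / 2) * fun x =>
      ENNReal.ofReal (Real.exp (t * (c * x + a) ^ 2))) x = ENNReal.ofReal
        ((√Real.pi)⁻¹ * Real.exp (a ^ 2 * (t / b)) * Real.exp (-b * (x - t * c * a / b) ^ 2)) := by
    intro x
    rw [Pi.mul_apply, gaussianPDF, ← ENNReal.ofReal_mul (gaussianPDFReal_nonneg _ _ _)]
    congr 1
    have h2 : (2 : ℝ) * Real.pi * ((1 / 2 : NNReal) : ℝ) = Real.pi := by
      push_cast; ring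
    have h3 : (2 : ℝ) * ((1 / 2 : NNReal) : ℝ) = 1 := by push_cast; ring
    rw [gaussianPDFReal, h2, h3, mul_assoc, mul_assoc, ← Real.exp_add, ← Real.exp_add]
    congr 2
    have hc : c ^ 2 * t = 1 - b := by rw [hbdef]; ring
    field_simp
    linear_combination (b * x ^ 2 + a ^ 2 * t) * hc
  simp_rw [hpt]
  have hI : Integrable fun x : ℝ => Real.exp (-b * (x - t * c * a / b) ^ 2) :=
    (integrable_exp_neg_mul_sq hb).comp_sub_right _
  rw [← ofReal_integral_eq_lintegral_ofReal (hI.const_mul _)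
    (ae_of_all _ fun x => by positivity), integral_const_mul,
    integral_sub_right_eq_self (fun x : ℝ => Real.exp (-b * x ^ 2)), integral_gaussian,
    Real.sqrt_div Real.pi_pos.le]
  congr 1
  have : √Real.pi ≠ 0 := (Real.sqrt_pos.2 Real.pi_pos).ne'
  field_simp

/-! ### The noncentral chi-square law. -/

theorem lintegral_pow_mul_exp_neg_Ioi (j : ℕ) {b : ℝ} (hb : 0 < b) :
    ∫⁻ z in Set.Ioi (0 : ℝ), ENNReal.ofReal (z ^ j * Real.exp (-(b * z))) =
      ENNReal.ofReal (j.factorial / b ^ (j + 1)) := by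
  have h := Real.integral_rpow_mul_exp_neg_mul_Ioi (a := (j : ℝ) + 1) (by positivity) hb
  have h' : ∫ z in Set.Ioi (0 : ℝ), z ^ j * Real.exp (-(b * z)) = j.factorial / b ^ (j + 1) := by
    rw [Real.Gamma_nat_eq_factorial] at h
    have e : ((j : ℝ) + 1) = ((j + 1 : ℕ) : ℝ) := by push_cast; ring
    simp only [add_sub_cancel_right, Real.rpow_natCast] at h
    rw [h, e, Real.rpow_natCast, one_div, inv_pow, inv_mul_eq_div]
  rw [← ofReal_integral_eq_lintegral_ofReal _ _, h']
  · exact .of_integral_ne_zero (by rw [h']; positivity)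
  · filter_upwards [ae_restrict_mem measurableSet_Ioi] with z hz
    have : (0 : ℝ) < z := hz
    positivity

/-- The `k`-th term in the expansion of the noncentral chi-square density with `2 * (n + 1)`
degrees of freedom, scale `θ` and noncentrality `A` as a mixture of Gamma densities. -/
noncomputable def noncentralTerm (n : ℕ) (θ A : ℝ) (k : ℕ) (z : ℝ) : ℝ :=
  Real.exp (-((z + A) / θ)) *
    (A ^ k * z ^ (n + k) / (θ ^ (2 * k + n + 1) * (k.factorial * (n + k).factorial)))

/-- The noncentral chi-square density with `2 * (n + 1)` degrees of freedom, scale `θ` and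
noncentrality `A`; for `A = 0` it is a Gamma density. -/
noncomputable def noncentralPDF (n : ℕ) (θ A z : ℝ) : ENNReal :=
  (Set.Ioi (0 : ℝ)).indicator (fun z => ∑' k, ENNReal.ofReal (noncentralTerm n θ A k z)) z

theorem measurable_noncentralPDF (n : ℕ) (θ : ℝ) :
    Measurable fun p : ℝ × ℝ => noncentralPDF n θ p.1 p.2 := by
  have h : Measurable fun p : ℝ × ℝ => ∑' k, ENNReal.ofReal (noncentralTerm n θ p.1 k p.2) := by
    refine Measurable.tsum fun k => ?_
    unfold noncentralTerm
    fun_prop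
  exact h.indicator (measurable_snd measurableSet_Ioi)

theorem noncentralTerm_nonneg {n k : ℕ} {θ A z : ℝ} (hθ : 0 < θ) (hA : 0 ≤ A) (hz : 0 ≤ z) :
    0 ≤ noncentralTerm n θ A k z := by
  unfold noncentralTerm; positivity

/-- Multiplying by `exp(t z)` changes the rate of each Gamma term from `1/θ` to `b/θ`, with `b = 1 -
θt`. The termwise integrals form the exponential series of `A/(θb)`, and `A/(θb) - A/θ = At/b`. -/
theorem lintegral_exp_noncentralPDF (n : ℕ) {θ A t : ℝ} (hθ : 0 < θ) (hA : 0 ≤ A)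
    (ht : θ * t < 1) :
    ∫⁻ z, ENNReal.ofReal (Real.exp (t * z)) ∂volume.withDensity (noncentralPDF n θ A) =
      ENNReal.ofReal (((1 - θ * t) ^ (n + 1))⁻¹ * Real.exp (A * (t / (1 - θ * t)))) := by
  have hb : 0 < 1 - θ * t := by linarith
  have hm : Measurable (noncentralPDF n θ A) :=
    (measurable_noncentralPDF n θ).comp measurable_prodMk_left
  rw [lintegral_withDensity_eq_lintegral_mul _ hm (by fun_prop)]
  set b := 1 - θ * t with hbdef
  have hbt : 0 < b / θ := by positivity
  have hpt : ∀ z : ℝ, (noncentralPDF n θ A * fun z => ENNReal.ofReal (Real.exp (t * z))) z =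
      (Set.Ioi (0 : ℝ)).indicator (fun z => ∑' k, ENNReal.ofReal (Real.exp (-(A / θ)) *
        (A ^ k / (θ ^ (2 * k + n + 1) * (k.factorial * (n + k).factorial)))) *
          ENNReal.ofReal (z ^ (n + k) * Real.exp (-(b / θ * z)))) z := by
    intro z
    rw [Pi.mul_apply, noncentralPDF]
    by_cases hz : z ∈ Set.Ioi (0 : ℝ)
    · rw [Set.indicator_of_mem hz, Set.indicator_of_mem hz, ← ENNReal.tsum_mul_right]
      refine tsum_congr fun k => ?_
      rw [← ENNReal.ofReal_mul (noncentralTerm_nonneg hθ hA (le_of_lt hz)),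
        ← ENNReal.ofReal_mul (by positivity), noncentralTerm]
      congr 1
      have he : Real.exp (-((z + A) / θ)) * Real.exp (t * z) =
          Real.exp (-(A / θ)) * Real.exp (-(b / θ * z)) := by
        rw [← Real.exp_add, ← Real.exp_add]
        congr 1
        rw [hbdef]
        field_simp
        ring
      linear_combination (A ^ k * z ^ (n + k) /
        (θ ^ (2 * k + n + 1) * (k.factorial * (n + k).factorial))) * he
    · simp [Set.indicator_of_notMem hz]
  simp_rw [hpt]
  rw [lintegral_indicator measurableSet_Ioi, lintegral_tsum fun k => by fun_prop]
  have hk : ∀ k : ℕ, ∫⁻ z in Set.Ioi (0 : ℝ), ENNReal.ofReal (Real.exp (-(A / θ)) *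
        (A ^ k / (θ ^ (2 * k + n + 1) * (k.factorial * (n + k).factorial)))) *
          ENNReal.ofReal (z ^ (n + k) * Real.exp (-(b / θ * z))) =
      ENNReal.ofReal (Real.exp (-(A / θ)) * (b ^ (n + 1))⁻¹ *
        ((A / (θ * b)) ^ k / k.factorial)) := by
    intro k
    rw [lintegral_const_mul _ (by fun_prop), lintegral_pow_mul_exp_neg_Ioi _ hbt,
      ← ENNReal.ofReal_mul (by positivity)]
    congr 1
    have : ((n + k).factorial : ℝ) ≠ 0 := by positivity
    rw [div_pow, div_pow, mul_pow]
    field_simp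
    ring
  simp_rw [hk]
  have hs := NormedSpace.expSeries_div_hasSum_exp (A / (θ * b))
  rw [← Real.exp_eq_exp_ℝ] at hs
  have hs' := hs.mul_left (Real.exp (-(A / θ)) * (b ^ (n + 1))⁻¹)
  rw [← ENNReal.ofReal_tsum_of_nonneg (fun k => by positivity) hs'.summable, hs'.tsum_eq]
  congr 1
  rw [mul_right_comm, ← Real.exp_add, mul_comm]
  congr 2
  rw [hbdef] at hb ⊢
  field_simp
  ring

/-- The sum of the squares of `2 * (n + 1)` independent Gaussian variables of variance `c ^ 2 / 2`
and means `a k` has a noncentral chi-square law. -/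
theorem map_sum_sq_gaussian {κ : Type*} [Fintype κ] (n : ℕ)
    (hκ : Fintype.card κ = 2 * (n + 1)) {c : ℝ} (hc : c ≠ 0) (a : κ → ℝ) :
    (Measure.pi fun _ : κ => gaussianReal 0 (1 / 2)).map
        (fun v => ∑ k, (c * v k + a k) ^ 2) =
      volume.withDensity (noncentralPDF n (c ^ 2) (∑ k, a k ^ 2)) := by
  have hθ : 0 < c ^ 2 := by positivity
  have hA : 0 ≤ ∑ k, a k ^ 2 := Finset.sum_nonneg fun k _ => sq_nonneg _
  have hL : ∀ t < 1 / c ^ 2, ∫⁻ x, ENNReal.ofReal (Real.exp (t * x))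
      ∂(Measure.pi fun _ : κ => gaussianReal 0 (1 / 2)).map (fun v => ∑ k, (c * v k + a k) ^ 2) =
      ENNReal.ofReal (((1 - c ^ 2 * t) ^ (n + 1))⁻¹ *
        Real.exp ((∑ k, a k ^ 2) * (t / (1 - c ^ 2 * t)))) := by
    intro t ht
    have ht' : c ^ 2 * t < 1 := by rwa [lt_div_iff₀' hθ] at ht
    rw [lintegral_map (by fun_prop) (by fun_prop)]
    have hprod : ∀ v : κ → ℝ, ENNReal.ofReal (Real.exp (t * ∑ k, (c * v k + a k) ^ 2)) =
        ∏ k, ENNReal.ofReal (Real.exp (t * (c * v k + a k) ^ 2)) := by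
      intro v
      rw [Finset.mul_sum, Real.exp_sum,
        ENNReal.ofReal_prod_of_nonneg fun k _ => (Real.exp_pos _).le]
    simp_rw [hprod]
    have hind := iIndepFun_pi (μ := fun _ : κ => gaussianReal 0 (1 / 2))
      (X := fun k x => ENNReal.ofReal (Real.exp (t * (c * x + a k) ^ 2)))
      (fun k => by fun_prop)
    rw [lintegral_prod_eq_prod_lintegral_of_indepFun _ _ hind (fun k => by fun_prop)]
    have hk : ∀ k, ∫⁻ v : κ → ℝ, ENNReal.ofReal (Real.exp (t * (c * v k + a k) ^ 2))
        ∂(Measure.pi fun _ : κ => gaussianReal 0 (1 / 2)) =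
        ENNReal.ofReal ((√(1 - c ^ 2 * t))⁻¹ *
          Real.exp (a k ^ 2 * (t / (1 - c ^ 2 * t)))) := by
      intro k
      rw [← lintegral_exp_sq_gaussianReal c (a k) t ht']
      exact (measurePreserving_eval (fun _ : κ => gaussianReal 0 (1 / 2)) k).lintegral_comp
        (f := fun x => ENNReal.ofReal (Real.exp (t * (c * x + a k) ^ 2))) (by fun_prop)
    simp_rw [hk]
    rw [← ENNReal.ofReal_prod_of_nonneg fun k _ => by positivity, Finset.prod_mul_distrib,
      Finset.prod_const, Finset.card_univ, hκ, ← Real.exp_sum, ← Finset.sum_mul, pow_mul, inv_pow,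
      Real.sq_sqrt (by linarith), inv_pow]
  have hR : ∀ t < 1 / c ^ 2, ∫⁻ z, ENNReal.ofReal (Real.exp (t * z))
      ∂volume.withDensity (noncentralPDF n (c ^ 2) (∑ k, a k ^ 2)) = _ := fun t ht =>
    lintegral_exp_noncentralPDF n hθ hA (by rwa [lt_div_iff₀' hθ] at ht)
  have hr : 0 < 1 / c ^ 2 := by positivity
  -- The total mass is the exponential moment at `t = 0`.
  have : IsFiniteMeasure (volume.withDensity (noncentralPDF n (c ^ 2) (∑ k, a k ^ 2))) := by
    constructor
    have := hR 0 hr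
    simp only [zero_mul, Real.exp_zero, ENNReal.ofReal_one, lintegral_const, one_mul] at this
    rw [this]
    exact ENNReal.ofReal_lt_top
  refine measure_ext_of_lintegral_exp hr (fun t ht => ?_) (fun t ht => ?_)
  · rw [hL t ht]; exact ENNReal.ofReal_ne_top
  · rw [hL t ht, hR t ht]

/-! ### Joint law of the gains by conditioning on port `0`. -/

/-- Two finite measures on a finite product that agree on measurable boxes are equal. -/
theorem measure_pi_ext {ι : Type*} [Finite ι] {E : ι → Type*} [∀ i, MeasurableSpace (E i)]
    {μ ν : Measure (∀ i, E i)} [IsFiniteMeasure μ]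
    (h : ∀ s : ∀ i, Set (E i), (∀ i, MeasurableSet (s i)) →
      μ (Set.univ.pi s) = ν (Set.univ.pi s)) : μ = ν := by
  refine ext_of_generate_finite _ generateFrom_pi.symm isPiSystem_pi ?_ ?_
  · rintro _ ⟨s, hs, rfl⟩
    exact h s fun i => hs i (Set.mem_univ i)
  · simpa using h (fun _ => Set.univ) fun _ => .univ

/-- The precoding gains as functions of the driving Gaussian variables grouped by port. -/
noncomputable def gainMap {κ : Type*} [Fintype κ] (M : ℕ) (σ ρ : ℝ)
    (w : Fin (M + 1) → κ → ℝ) : Fin (M + 1) → ℝ :=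
  Fin.cons (∑ k, (σ * w 0 k) ^ 2)
    fun i => ∑ k, (σ * √(1 - ρ ^ 2) * w i.succ k + σ * ρ * w 0 k) ^ 2

/-- The joint density of the precoding gains, as a product of noncentral chi-square densities. -/
noncomputable def gainPDF (n M : ℕ) (σ ρ : ℝ) (z : Fin (M + 1) → ℝ) : ENNReal :=
  noncentralPDF n (σ ^ 2) 0 (z 0) *
    ∏ i : Fin M, noncentralPDF n (σ ^ 2 * (1 - ρ ^ 2)) (ρ ^ 2 * z 0) (z i.succ)

theorem measurable_noncentralPDF_comp {α : Type*} [MeasurableSpace α] (n : ℕ) (θ : ℝ)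
    {f g : α → ℝ} (hf : Measurable f) (hg : Measurable g) :
    Measurable fun a => noncentralPDF n θ (f a) (g a) :=
  Measurable.comp (g := fun p : ℝ × ℝ => noncentralPDF n θ p.1 p.2) (f := fun a => (f a, g a))
    (measurable_noncentralPDF n θ) (hf.prodMk hg)

theorem measurable_gainPDF (n M : ℕ) (σ ρ : ℝ) : Measurable (gainPDF n M σ ρ) := by
  unfold gainPDF
  exact (measurable_noncentralPDF_comp _ _ (by fun_prop) (by fun_prop)).mul
    (Finset.measurable_fun_prod _ fun i _ =>
      measurable_noncentralPDF_comp _ _ (by fun_prop) (by fun_prop))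

theorem measurable_gainMap {κ : Type*} [Fintype κ] (M : ℕ) (σ ρ : ℝ) :
    Measurable (gainMap (κ := κ) M σ ρ) := by
  refine measurable_pi_iff.2 fun j => ?_
  refine Fin.cases ?_ (fun i => ?_) j
  · simp only [gainMap, Fin.cons_zero]; fun_prop
  · simp only [gainMap, Fin.cons_succ]; fun_prop

/-- Tonelli with coordinate `0` split off: once `z 0` is fixed, the remaining factors involve
separate coordinates. This is the form that the conditioning in `map_gainMap` produces. -/
theorem gainPDF_box (n M : ℕ) (σ ρ : ℝ) (s : Fin (M + 1) → Set ℝ)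
    (hs : ∀ i, MeasurableSet (s i)) :
    volume.withDensity (gainPDF n M σ ρ) (Set.univ.pi s) =
      ∫⁻ z in s 0, noncentralPDF n (σ ^ 2) 0 z *
        ∏ i : Fin M, ∫⁻ y in s i.succ, noncentralPDF n (σ ^ 2 * (1 - ρ ^ 2)) (ρ ^ 2 * z) y := by
  have hm : ∀ (θ A : ℝ), Measurable (noncentralPDF n θ A) := fun θ A =>
    measurable_noncentralPDF_comp n θ measurable_const measurable_id
  rw [withDensity_apply _ (.univ_pi hs), volume_pi, Measure.restrict_pi_pi,
    ← ((measurePreserving_piFinSuccAbove (fun i => volume.restrict (s i)) 0).symm).lintegral_comp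
      (measurable_gainPDF n M σ ρ)]
  rw [lintegral_prod (fun p => gainPDF n M σ ρ
    ((MeasurableEquiv.piFinSuccAbove (fun _ : Fin (M + 1) => ℝ) 0).symm p))
    ((measurable_gainPDF n M σ ρ).comp (MeasurableEquiv.measurable _)).aemeasurable]
  simp only [MeasurableEquiv.piFinSuccAbove_symm_apply, Fin.insertNthEquiv, gainPDF]
  refine lintegral_congr fun z => ?_
  have := lintegral_fin_prod_eq_prod (μ := fun i : Fin M => volume.restrict (s i.succ))
    (f := fun i => noncentralPDF n (σ ^ 2 * (1 - ρ ^ 2)) (ρ ^ 2 * z)) fun i => hm _ _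
  have hprod : Measurable fun y : Fin M → ℝ =>
      ∏ i, noncentralPDF n (σ ^ 2 * (1 - ρ ^ 2)) (ρ ^ 2 * z) (y i) :=
    Finset.measurable_fun_prod _ fun i _ => (hm _ _).comp (measurable_pi_apply i)
  rw [← this, ← lintegral_const_mul _ hprod]
  simp

/-- Both sides are compared on boxes. The noise `u` of port `0` is integrated last, and the inner
probability depends on `u` only through the gain of port `0`, so the outer integral can be pushed
forward to the law of that gain. -/
theorem map_gainMap {κ : Type*} [Fintype κ] (n M : ℕ) (hκ : Fintype.card κ = 2 * (n + 1))
    {σ ρ : ℝ} (hσ : 0 < σ) (hρ : ρ ^ 2 < 1) :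
    (Measure.pi fun _ : Fin (M + 1) => Measure.pi fun _ : κ => gaussianReal 0 (1 / 2)).map
      (gainMap M σ ρ) = volume.withDensity (gainPDF n M σ ρ) := by
  set ν : Measure (κ → ℝ) := Measure.pi fun _ : κ => gaussianReal 0 (1 / 2) with hν
  have hG := measurable_gainMap (κ := κ) M σ ρ
  have : IsFiniteMeasure ((Measure.pi fun _ : Fin (M + 1) => ν).map (gainMap M σ ρ)) :=
    Measure.isFiniteMeasure_map _ _
  refine measure_pi_ext fun s hs => ?_
  rw [gainPDF_box n M σ ρ s hs, Measure.map_apply hG (.univ_pi hs),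
    ← ((measurePreserving_piFinSuccAbove (fun _ => ν) 0).symm).measure_preimage
      (hG (.univ_pi hs)).nullMeasurableSet,
    Measure.prod_apply ((MeasurableEquiv.measurable _) (hG (.univ_pi hs)))]
  set F : ℝ → ENNReal := fun z =>
    ∏ i : Fin M, ∫⁻ y in s i.succ, noncentralPDF n (σ ^ 2 * (1 - ρ ^ 2)) (ρ ^ 2 * z) y with hF
  have hFm : Measurable F := by
    refine Finset.measurable_fun_prod _ fun i _ => ?_
    exact Measurable.lintegral_prod_right'
      (f := fun p : ℝ × ℝ => noncentralPDF n (σ ^ 2 * (1 - ρ ^ 2)) (ρ ^ 2 * p.1) p.2)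
      (measurable_noncentralPDF_comp _ _ (by fun_prop) (by fun_prop))
  have hc : σ * √(1 - ρ ^ 2) ≠ 0 :=
    mul_ne_zero hσ.ne' (Real.sqrt_pos.2 (by linarith)).ne'
  have hc2 : (σ * √(1 - ρ ^ 2)) ^ 2 = σ ^ 2 * (1 - ρ ^ 2) := by
    rw [mul_pow, Real.sq_sqrt (by linarith)]
  -- The spurious `+ 0` gives the gain of port `0` the shape required by `map_sum_sq_gaussian` with
  -- zero means.
  have hsec : ∀ u : κ → ℝ, Measure.pi (fun _ : Fin M => ν) (Prod.mk u ⁻¹'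
      ((MeasurableEquiv.piFinSuccAbove (fun _ => κ → ℝ) 0).symm ⁻¹'
        (gainMap M σ ρ ⁻¹' Set.univ.pi s))) =
      (s 0).indicator F (∑ k, (σ * u k + 0) ^ 2) := by
    intro u
    simp only [add_zero]
    have hset : Prod.mk u ⁻¹' ((MeasurableEquiv.piFinSuccAbove (fun _ => κ → ℝ) 0).symm ⁻¹'
        (gainMap M σ ρ ⁻¹' Set.univ.pi s)) =
        {_v : Fin M → κ → ℝ | ∑ k, (σ * u k) ^ 2 ∈ s 0} ∩ Set.univ.pi fun i : Fin M =>
          (fun v : κ → ℝ => ∑ k, (σ * √(1 - ρ ^ 2) * v k + σ * ρ * u k) ^ 2) ⁻¹' s i.succ := by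
      ext v
      simp [Set.mem_pi, Fin.forall_fin_succ, gainMap, Fin.insertNthEquiv]
    rw [hset]
    by_cases hu : ∑ k, (σ * u k) ^ 2 ∈ s 0
    · rw [Set.indicator_of_mem hu]
      simp only [hu, Set.ofPred_true, Set.univ_inter]
      rw [Measure.pi_pi, hF]
      refine Finset.prod_congr rfl fun i _ => ?_
      rw [← Measure.map_apply (by fun_prop) (hs _),
        map_sum_sq_gaussian n hκ hc (fun k => σ * ρ * u k), withDensity_apply _ (hs _), hc2]
      have : ∑ k, (σ * ρ * u k) ^ 2 = ρ ^ 2 * ∑ k, (σ * u k) ^ 2 := by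
        rw [Finset.mul_sum]
        exact Finset.sum_congr rfl fun k _ => by ring
      rw [this]
    · rw [Set.indicator_of_notMem hu]
      simp [hu]
  rw [lintegral_congr hsec, ← lintegral_map (f := (s 0).indicator F)
    (g := fun u : κ → ℝ => ∑ k, (σ * u k + 0) ^ 2) (hFm.indicator (hs 0)) (by fun_prop),
    map_sum_sq_gaussian n hκ hσ.ne' fun _ => 0, lintegral_indicator (hs 0),
    setLIntegral_withDensity_eq_setLIntegral_mul _
      (f := noncentralPDF n (σ ^ 2) (∑ _ : κ, 0 ^ 2))
      (measurable_noncentralPDF_comp _ _ measurable_const measurable_id) hFm (hs 0)]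
  simp [hF]

/-! ### Closed form of the densities. -/

theorem noncentralPDF_zero (n : ℕ) (θ : ℝ) {z : ℝ} (hz : 0 < z) :
    noncentralPDF n θ 0 z =
      ENNReal.ofReal (z ^ n / (θ ^ (n + 1) * n.factorial) * Real.exp (-(z / θ))) := by
  rw [noncentralPDF, Set.indicator_of_mem (Set.mem_Ioi.2 hz), tsum_eq_single 0]
  · simp [noncentralTerm, mul_comm]
  · intro k hk
    simp [noncentralTerm, hk]

theorem noncentralPDF_of_nonpos (n : ℕ) (θ A : ℝ) {z : ℝ} (hz : z ≤ 0) :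
    noncentralPDF n θ A z = 0 :=
  Set.indicator_of_notMem (by simpa using hz) _

/-- The noncentral chi-square density in terms of the Bessel function. -/
theorem noncentralPDF_eq_besselI (n : ℕ) {θ A z : ℝ} (hθ : 0 < θ) (hA : 0 < A) (hz : 0 < z) :
    noncentralPDF n θ A z = ENNReal.ofReal (1 / θ * Real.exp (-((z + A) / θ)) *
      (z / A) ^ ((n : ℝ) / 2) * besselI n (√(4 * A * z) / θ)) := by
  have hterm : ∀ k : ℕ, noncentralTerm n θ A k z =
      1 / θ * Real.exp (-((z + A) / θ)) * (z / A) ^ ((n : ℝ) / 2) *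
        ((√(4 * A * z) / θ / 2) ^ (2 * k + n) / (k.factorial * (n + k).factorial)) := by
    intro k
    have h1 : (z / A) ^ ((n : ℝ) / 2) = (√z / √A) ^ n := by
      rw [← Real.sqrt_div hz.le, Real.sqrt_eq_rpow, ← Real.rpow_natCast, ← Real.rpow_mul
        (by positivity)]
      congr 1
      ring
    have h2 : √(4 * A * z) / θ / 2 = √A * √z / θ := by
      rw [Real.sqrt_mul (by positivity), Real.sqrt_mul (by norm_num),
        show (4 : ℝ) = 2 ^ 2 by norm_num, Real.sqrt_sq (by norm_num)]
      field_simp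
    have ha := Real.sqrt_pos.2 hA
    have hA2 : A ^ k = √A ^ (2 * k) := by rw [pow_mul, Real.sq_sqrt hA.le]
    have hz2 : z ^ (n + k) = √z ^ (2 * (n + k)) := by rw [pow_mul, Real.sq_sqrt hz.le]
    rw [noncentralTerm, h1, h2, hA2, hz2, div_pow, div_pow, mul_pow]
    field_simp
    ring
  -- Dropping `(n + k)! ≥ 1` from the denominator leaves a multiple of an exponential series.
  have hsum : Summable fun k => noncentralTerm n θ A k z := by
    have h := (Real.summable_pow_div_factorial (A * z / θ ^ 2)).mul_left
      (Real.exp (-((z + A) / θ)) * (z ^ n / θ ^ (n + 1)))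
    refine h.of_nonneg_of_le (fun k => noncentralTerm_nonneg hθ hA.le hz.le) fun k => ?_
    have hf : (1 : ℝ) ≤ (n + k).factorial := by
      exact_mod_cast Nat.succ_le_of_lt (n + k).factorial_pos
    have he : noncentralTerm n θ A k z = Real.exp (-((z + A) / θ)) * (z ^ n / θ ^ (n + 1)) *
        ((A * z / θ ^ 2) ^ k / k.factorial) / (n + k).factorial := by
      rw [noncentralTerm, div_pow, mul_pow]
      field_simp
      ring
    rw [he]
    exact div_le_self (by positivity) hf
  rw [noncentralPDF, Set.indicator_of_mem (Set.mem_Ioi.2 hz),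
    ← ENNReal.ofReal_tsum_of_nonneg (fun k => noncentralTerm_nonneg hθ hA.le hz.le) hsum,
    besselI, ← tsum_mul_left]
  simp_rw [hterm]

theorem besselI_nonneg (n : ℕ) {t : ℝ} (ht : 0 ≤ t) : 0 ≤ besselI n t :=
  tsum_nonneg fun k => by positivity

/-- Here `ρ ≠ 0` matters: the Bessel form divides by the noncentrality `ρ² z 0`. Off the positive
orthant a factor of `gainPDF` vanishes. -/
theorem ofReal_jointDensity (n M : ℕ) {σ ρ : ℝ} (hσ : 0 < σ) (hρ0 : ρ ≠ 0) (hρ : ρ ^ 2 < 1)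
    (z : Fin (M + 1) → ℝ) :
    ENNReal.ofReal (jointDensity (n + 1) σ ρ z) = gainPDF n M σ ρ z := by
  have hθ : 0 < σ ^ 2 * (1 - ρ ^ 2) := mul_pos (by positivity) (by linarith)
  rw [jointDensity, gainPDF]
  split_ifs with hz
  · have h0 := hz 0
    have hA : 0 < ρ ^ 2 * z 0 := by positivity
    rw [noncentralPDF_zero n _ h0]
    simp_rw [fun i : Fin M => noncentralPDF_eq_besselI n hθ hA (hz i.succ)]
    rw [← ENNReal.ofReal_prod_of_nonneg fun i _ => ?_, ← ENNReal.ofReal_mul (by positivity)]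
    · congr 1
      rw [Fin.univ_succ, Finset.erase_cons, Finset.prod_map]
      simp [pow_mul, mul_assoc]
    · have := hz i.succ
      have := besselI_nonneg n (t := √(4 * (ρ ^ 2 * z 0) * z i.succ) / (σ ^ 2 * (1 - ρ ^ 2)))
        (by positivity)
      positivity
  · rw [ENNReal.ofReal_zero]
    push Not at hz
    obtain ⟨j, hj⟩ := hz
    revert hj
    refine Fin.cases (fun hj => ?_) (fun i hj => ?_) j
    · rw [noncentralPDF_of_nonpos _ _ _ hj, zero_mul]
    · rw [Finset.prod_eq_zero (Finset.mem_univ i) (noncentralPDF_of_nonpos _ _ _ hj), mul_zero]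

/-! ### From the channel model to the Gaussian product measure. -/

/-- The driving noise grouped by port. -/
def portNoise {Ω : Type*} {M N : ℕ} (x y : Fin M → Fin N → Ω → ℝ) (ω : Ω) (m : Fin M) :
    Fin N ⊕ Fin N → ℝ :=
  Sum.elim (fun n => x m n ω) (fun n => y m n ω)

theorem hasLaw_portNoise {Ω : Type*} [MeasurableSpace Ω] {μ : Measure Ω} [IsProbabilityMeasure μ]
    {M N : ℕ} {x y : Fin M → Fin N → Ω → ℝ} (h : IsDrivingNoise x y μ) :
    HasLaw (portNoise x y) (Measure.pi fun _ : Fin M =>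
      Measure.pi fun _ : Fin N ⊕ Fin N => gaussianReal 0 (1 / 2)) μ := by
  set X : Fin M × (Fin N ⊕ Fin N) → Ω → ℝ := fun p ω => portNoise x y ω p.1 p.2 with hX
  -- This reindexing turns independence of the two families `x`, `y` into independence of one family
  -- indexed by port first. Currying the product law then groups it by port.
  let g : Fin M × (Fin N ⊕ Fin N) → (Fin M × Fin N) ⊕ (Fin M × Fin N) :=
    fun p => p.2.elim (fun n => .inl (p.1, n)) (fun n => .inr (p.1, n))
  have hg : Function.Injective g := by
    rintro ⟨m, n | n⟩ ⟨m', n' | n'⟩ hp <;> simp_all [g]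
  have hind : iIndepFun X μ := by
    have := h.indep.precomp hg
    convert this using 1
    ext p ω
    rcases p with ⟨m, n | n⟩ <;> rfl
  have hlaw : ∀ p, HasLaw (X p) (gaussianReal 0 (1 / 2)) μ := by
    rintro ⟨m, n | n⟩
    · exact h.law_x m n
    · exact h.law_y m n
  have hae : AEMeasurable (fun ω p => X p ω) μ :=
    aemeasurable_pi_iff.2 fun p => (hlaw p).aemeasurable
  have hall := hind.hasLaw_infinitePi hlaw hae
  have hcurry := Measure.infinitePi_map_curry
    (fun (_ : Fin M) (_ : Fin N ⊕ Fin N) => gaussianReal 0 (1 / 2))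
  simp_rw [Measure.infinitePi_eq_pi] at hcurry
  rw [Measure.infinitePi_eq_pi] at hall
  exact HasLaw.comp ⟨by fun_prop, hcurry⟩ hall

theorem precodingGain_eq_gainMap {Ω : Type*} {M N : ℕ} (σ ρ : ℝ)
    (x y : Fin (M + 1) → Fin N → Ω → ℝ) (ω : Ω) :
    (fun m => precodingGain σ ρ x y m ω) = gainMap M σ ρ (portNoise x y ω) := by
  have hn : ∀ a b : ℝ, ‖(a : ℂ) + Complex.I * (b : ℂ)‖ ^ 2 = a ^ 2 + b ^ 2 := by
    intro a b
    rw [Complex.sq_norm, mul_comm, Complex.normSq_add_mul_I]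
  funext m
  refine Fin.cases ?_ (fun i => ?_) m
  · simp only [precodingGain, channel, if_true, hn, gainMap, Fin.cons_zero, portNoise,
      Fintype.sum_sum_type, Sum.elim_inl, Sum.elim_inr, Finset.sum_add_distrib]
  · simp only [precodingGain, channel, Fin.succ_ne_zero, if_false, hn, gainMap, Fin.cons_succ,
      portNoise, Fintype.sum_sum_type, Sum.elim_inl, Sum.elim_inr, Finset.sum_add_distrib]
    congr 1 <;> exact Finset.sum_congr rfl fun n _ => by ring

end MisoFas

theorem lemma1 {Ω : Type*} [MeasurableSpace Ω] (μ : Measure Ω) [IsProbabilityMeasure μ]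
    (M N : ℕ) [NeZero M] (hN : 1 ≤ N) (σ ρ : ℝ) (hσ : 0 < σ) (hρ0 : ρ ≠ 0) (hρ1 : |ρ| < 1)
    (x y : Fin M → Fin N → Ω → ℝ) (hxy : MisoFas.IsDrivingNoise x y μ) :
    HasPDF (fun ω m => MisoFas.precodingGain σ ρ x y m ω) μ volume ∧
      pdf (fun ω m => MisoFas.precodingGain σ ρ x y m ω) μ volume =ᵐ[volume]
        fun z : Fin M → ℝ => ENNReal.ofReal (MisoFas.jointDensity N σ ρ z) := by
  obtain ⟨n, rfl⟩ : ∃ n, N = n + 1 := ⟨N - 1, by omega⟩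
  obtain ⟨m, rfl⟩ : ∃ m, M = m + 1 := ⟨M - 1, by have := NeZero.pos M; omega⟩
  have hρ : ρ ^ 2 < 1 := by rwa [sq_lt_one_iff_abs_lt_one]
  have hfun : (fun ω j => MisoFas.precodingGain σ ρ x y j ω) =
      MisoFas.gainMap m σ ρ ∘ MisoFas.portNoise x y :=
    funext fun ω => MisoFas.precodingGain_eq_gainMap σ ρ x y ω
  have hden : (fun z : Fin (m + 1) → ℝ => ENNReal.ofReal (MisoFas.jointDensity (n + 1) σ ρ z)) =
      MisoFas.gainPDF n m σ ρ :=
    funext fun z => MisoFas.ofReal_jointDensity n m hσ hρ0 hρ z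
  have hlaw : HasLaw (MisoFas.gainMap m σ ρ ∘ MisoFas.portNoise x y)
      (volume.withDensity (MisoFas.gainPDF n m σ ρ)) μ :=
    HasLaw.comp ⟨(MisoFas.measurable_gainMap m σ ρ).aemeasurable,
      MisoFas.map_gainMap n m (by simp; ring) hσ hρ⟩ (MisoFas.hasLaw_portNoise hxy)
  have hm := (MisoFas.measurable_gainPDF n m σ ρ).aemeasurable (μ := volume)
  rw [hfun, hden]
  have hpdf := hasPDF_of_map_eq_withDensity hlaw.aemeasurable _ hm hlaw.map_eq
  exact ⟨hpdf, (pdf.eq_of_map_eq_withDensity _ hm).1 hlaw.map_eq⟩
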